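/- Let $d > 0$ be an integer. Let $\bar U_d$ be the scheme over $\operatorname{Spec}\mathbb{Z}[t]$ of pairs of $d\times d$ matrices $A$, $B$ satisfying $AB = BA = tI_d$, i.e. the spectrum of the quotient of the polynomial ring over $\mathbb{Z}[t]$ in the $2d^2$ entries of $A$ and $B$ by the ideal generated by the entries of $AB - tI_d$ and $BA - tI_d$. Let $U_d$ be the open subscheme of $\bar U_d$ consisting of the points at which $$\operatorname{rk} A + \operatorname{rk} B \ge d,$$ where the ranks at a point are those of the induced matrices over its residue field. Then $U_d$ is smooth over $\operatorname{Spec}\mathbb{Z}[t]$ of relative dimension $d^2$. -/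

import Mathlib

namespace MatrixPairs

open AlgebraicGeometry CategoryTheory

/-- The polynomial ring over `ℤ[t]` in the `2 d ^ 2` entries of two `d × d` matrices:
`Sum.inl (i, j)` indexes the entries of `A`, and `Sum.inr (i, j)` those of `B`. -/
abbrev EntryRing (d : ℕ) : Type :=
  MvPolynomial ((Fin d × Fin d) ⊕ (Fin d × Fin d)) (Polynomial ℤ)

/-- The generic matrix `A`. -/
noncomputable def genericA (d : ℕ) : Matrix (Fin d) (Fin d) (EntryRing d) :=
  Matrix.of fun i j => MvPolynomial.X (Sum.inl (i, j))

/-- The generic matrix `B`. -/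
noncomputable def genericB (d : ℕ) : Matrix (Fin d) (Fin d) (EntryRing d) :=
  Matrix.of fun i j => MvPolynomial.X (Sum.inr (i, j))

/-- The scalar matrix `t I_d` over the polynomial ring. -/
noncomputable def scalarT (d : ℕ) : Matrix (Fin d) (Fin d) (EntryRing d) :=
  Matrix.scalar (Fin d) (MvPolynomial.C Polynomial.X)

/-- The ideal generated by all entries of `A B - t I_d` and of `B A - t I_d`. -/
noncomputable def relations (d : ℕ) : Ideal (EntryRing d) :=
  Ideal.span
    ((Set.range fun p : Fin d × Fin d => (genericA d * genericB d - scalarT d) p.1 p.2) ∪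
      (Set.range fun p : Fin d × Fin d => (genericB d * genericA d - scalarT d) p.1 p.2))

/-- The coordinate ring of the scheme of pairs of matrices with `A B = B A = t I_d`. -/
abbrev CoordRing (d : ℕ) : Type := EntryRing d ⧸ relations d

/-- The universal matrix `A` over the coordinate ring. -/
noncomputable def univA (d : ℕ) : Matrix (Fin d) (Fin d) (CoordRing d) :=
  (genericA d).map (Ideal.Quotient.mk (relations d))

/-- The universal matrix `B` over the coordinate ring. -/
noncomputable def univB (d : ℕ) : Matrix (Fin d) (Fin d) (CoordRing d) :=
  (genericB d).map (Ideal.Quotient.mk (relations d))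

/-- The scheme of pairs of `d × d` matrices `A`, `B` over `ℤ[t]` with `A B = B A = t I_d`. -/
noncomputable def UBar (d : ℕ) : Scheme.{0} := Spec (CommRingCat.of (CoordRing d))

/-- The structure morphism to `Spec ℤ[t]`. -/
noncomputable def UBar.toBase (d : ℕ) : UBar d ⟶ Spec (CommRingCat.of (Polynomial ℤ)) :=
  Spec.map (CommRingCat.ofHom (algebraMap (Polynomial ℤ) (CoordRing d)))

/-- The rank of a matrix over a commutative ring at a point of the spectrum: the rank of the
induced matrix over the residue field of that point. -/
noncomputable def rankAt {R : Type*} [CommRing R] {d : ℕ} (M : Matrix (Fin d) (Fin d) R)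
    (x : PrimeSpectrum R) : ℕ :=
  (M.map (algebraMap R x.asIdeal.ResidueField)).rank

/-- A matrix over a field has a nonzero minor of the size of its rank. -/
lemma exists_minor_ne_zero {K : Type*} [Field K] {d : ℕ} (M : Matrix (Fin d) (Fin d) K) :
    ∃ f g : Fin M.rank → Fin d, (M.submatrix f g).det ≠ 0 := by
  have key : ∀ {m n r : ℕ} (N : Matrix (Fin m) (Fin n) K), N.rank = r →
      ∃ f : Fin r → Fin m, LinearIndependent K (fun i => N.row (f i)) := by
    intro m n r N hr
    rw [N.rank_eq_finrank_span_row] at hr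
    subst hr
    obtain ⟨v, hv, -, hli⟩ := Submodule.exists_fun_fin_finrank_span_eq K (Set.range N.row)
    choose f hf using hv
    exact ⟨f, by simpa only [hf] using hli⟩
  obtain ⟨f, hf⟩ := key M rfl
  have hrow : LinearIndependent K (M.submatrix f id).row := hf
  have hrank : (M.submatrix f id).transpose.rank = M.rank := by
    rw [Matrix.rank_transpose, hrow.rank_matrix, Fintype.card_fin]
  obtain ⟨g, hg⟩ := key (M.submatrix f id).transpose hrank
  refine ⟨f, g, ?_⟩
  have h : LinearIndependent K (M.submatrix f g).transpose.row := hg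
  rw [Matrix.linearIndependent_rows_iff_isUnit, Matrix.isUnit_iff_isUnit_det,
    Matrix.det_transpose] at h
  exact h.ne_zero

/-- The rank of a matrix is a lower semicontinuous function on the spectrum. -/
lemma isOpen_le_rankAt {R : Type*} [CommRing R] {d : ℕ} (M : Matrix (Fin d) (Fin d) R) (r : ℕ) :
    IsOpen {x : PrimeSpectrum R | r ≤ rankAt M x} := by
  rw [isOpen_iff_forall_mem_open]
  intro x hx
  obtain ⟨f, g, hfg⟩ := exists_minor_ne_zero (M.map (algebraMap R x.asIdeal.ResidueField))
  have hdet : ∀ y : PrimeSpectrum R,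
      ((M.map (algebraMap R y.asIdeal.ResidueField)).submatrix f g).det =
        algebraMap R y.asIdeal.ResidueField (M.submatrix f g).det := fun y => by
    rw [RingHom.map_det]; rfl
  refine ⟨PrimeSpectrum.basicOpen (M.submatrix f g).det, fun y hy => ?_,
    (PrimeSpectrum.basicOpen _).isOpen, ?_⟩
  · have hy' : ((M.map (algebraMap R y.asIdeal.ResidueField)).submatrix f g).det ≠ 0 := by
      rw [hdet, Ne, Ideal.algebraMap_residueField_eq_zero]
      exact hy
    have h := Matrix.rank_submatrix_le (M.map (algebraMap R y.asIdeal.ResidueField)) f g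
    rw [Matrix.rank_of_det_ne_zero hy', Fintype.card_fin] at h
    exact le_trans hx h
  · rw [hdet, Ne, Ideal.algebraMap_residueField_eq_zero] at hfg
    exact hfg

/-- The locus where the ranks of two matrices add up to at least `d` is open. -/
lemma isOpen_le_rankAt_add {R : Type*} [CommRing R] {d : ℕ} (M N : Matrix (Fin d) (Fin d) R) :
    IsOpen {x : PrimeSpectrum R | d ≤ rankAt M x + rankAt N x} := by
  have h : {x : PrimeSpectrum R | d ≤ rankAt M x + rankAt N x} =
      ⋃ r : ℕ, {x | r ≤ rankAt M x} ∩ {x | d - r ≤ rankAt N x} := by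
    ext x
    simp only [Set.mem_ofPred_eq, Set.mem_iUnion, Set.mem_inter_iff]
    exact ⟨fun hx => ⟨rankAt M x, le_rfl, by omega⟩, fun ⟨r, h1, h2⟩ => by omega⟩
  rw [h]
  exact isOpen_iUnion fun r => (isOpen_le_rankAt _ _).inter (isOpen_le_rankAt _ _)

/-- The open subscheme of `UBar d` on which `rk A + rk B ≥ d`. -/
noncomputable def U (d : ℕ) : (UBar d).Opens :=
  ⟨{x : PrimeSpectrum (CoordRing d) | d ≤ rankAt (univA d) x + rankAt (univB d) x},
    isOpen_le_rankAt_add (univA d) (univB d)⟩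

/-- The structure morphism of the open subscheme to `Spec ℤ[t]`. -/
noncomputable def U.toBase (d : ℕ) :
    (U d).toScheme ⟶ Spec (CommRingCat.of (Polynomial ℤ)) :=
  (U d).ι ≫ UBar.toBase d

end MatrixPairs

namespace MatrixPairs

open AlgebraicGeometry CategoryTheory Matrix

/-! Smoothness is local, so explicit charts suffice. At a point of `U d`, let `r` be the rank of
`A`. After permuting rows and columns, the upper left `r × r` block `A₁₁` is invertible there. The
relations then express `B` through `A₁₁`, `A₁₂`, `A₂₁`, `B₂₂` (`eq_chartB_of_mul_eq`); where `B₂₂`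
is invertible too, they also give `A₂₂ = A₂₁ A₁₁⁻¹ A₁₂ + t B₂₂⁻¹` (`eq_chartA_of_mul_eq`).
Conversely, any four blocks with `A₁₁`, `B₂₂` invertible give a pair. Hence the locus where `det A₁₁
* det B₂₂` is a unit is a principal open in affine `d ^ 2`-space over `ℤ[t]`
(`IsUniversalPair.nonempty_algEquiv_away`). The rank condition puts the point in such a chart
(`isUnit_det_toBlocks₂₂`): if `t ≠ 0` in the residue field, then `A` is invertible and `B₂₂` is
empty; if `t = 0`, then `rk B ≤ rk B₂₂`, so `B₂₂` has full rank `d - r`. -/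

/-- The parameter of a pair of matrices: all blocks of the first matrix except the lower right one,
and the lower right block of the second. -/
def glue {m n S : Type*} (A B : Matrix (m ⊕ n) (m ⊕ n) S) : Matrix (m ⊕ n) (m ⊕ n) S :=
  fromBlocks A.toBlocks₁₁ A.toBlocks₁₂ A.toBlocks₂₁ B.toBlocks₂₂

lemma map_smul_ringHom {n S T : Type*} [CommRing S] [CommRing T] (f : S →+* T) (t : S)
    (M : Matrix n n S) : (t • M).map f = f t • M.map f := by
  ext i j
  simp

lemma glue_map {m n S T : Type*} [CommRing S] [CommRing T] (f : S →+* T)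
    (A B : Matrix (m ⊕ n) (m ⊕ n) S) : (glue A B).map f = glue (A.map f) (B.map f) := by
  rw [glue, fromBlocks_map]; rfl

/-! ### Explicit charts: block formulas for pairs with both products equal to `t` -/

section Chart

variable {m n : Type*} [Fintype m] [Fintype n] [DecidableEq m] [DecidableEq n]
variable {S : Type*} [CommRing S]

/-- The first matrix of the pair parametrized by `Z`: its lower right block is determined by the
other three blocks of `Z` and the inverse of the lower right block of `Z`. -/
noncomputable def chartA (t : S) (Z : Matrix (m ⊕ n) (m ⊕ n) S) : Matrix (m ⊕ n) (m ⊕ n) S :=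
  fromBlocks Z.toBlocks₁₁ Z.toBlocks₁₂ Z.toBlocks₂₁
    (Z.toBlocks₂₁ * Z.toBlocks₁₁⁻¹ * Z.toBlocks₁₂ + t • Z.toBlocks₂₂⁻¹)

/-- The second matrix of the pair parametrized by `Z`: its lower right block is that of `Z`. -/
noncomputable def chartB (t : S) (Z : Matrix (m ⊕ n) (m ⊕ n) S) : Matrix (m ⊕ n) (m ⊕ n) S :=
  fromBlocks
    (t • Z.toBlocks₁₁⁻¹ +
      Z.toBlocks₁₁⁻¹ * Z.toBlocks₁₂ * Z.toBlocks₂₂ * Z.toBlocks₂₁ * Z.toBlocks₁₁⁻¹)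
    (-(Z.toBlocks₁₁⁻¹ * Z.toBlocks₁₂ * Z.toBlocks₂₂))
    (-(Z.toBlocks₂₂ * Z.toBlocks₂₁ * Z.toBlocks₁₁⁻¹)) Z.toBlocks₂₂

/-- The product of the two diagonal minors that have to be invertible in a chart. -/
noncomputable def blockDet (Z : Matrix (m ⊕ n) (m ⊕ n) S) : S :=
  Z.toBlocks₁₁.det * Z.toBlocks₂₂.det

/-- Conceptually, `A = L * diag(A₁₁, t B₂₂⁻¹) * V` and `B = V⁻¹ * diag(t A₁₁⁻¹, B₂₂) * L⁻¹` with
`L`, `V` block unipotent, lower and upper triangular respectively; both products are therefore `t`.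
-/
lemma chartA_mul_chartB (t : S) {Z : Matrix (m ⊕ n) (m ⊕ n) S} (h : IsUnit (blockDet Z)) :
    chartA t Z * chartB t Z = t • 1 := by
  have h₁ := Matrix.mul_nonsing_inv _ (isUnit_of_mul_isUnit_left h)
  have h₂ := Matrix.nonsing_inv_mul _ (isUnit_of_mul_isUnit_right h)
  simp only [chartA, chartB, fromBlocks_multiply, ← fromBlocks_one, fromBlocks_smul]
  congr 1
  · simp [Matrix.mul_add, ← Matrix.mul_assoc, h₁]
  · simp [← Matrix.mul_assoc, h₁]
  · simp [Matrix.mul_add, Matrix.add_mul, ← Matrix.mul_assoc, h₂]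
    abel
  · simp [Matrix.add_mul, ← Matrix.mul_assoc, h₂]

lemma chartB_mul_chartA (t : S) {Z : Matrix (m ⊕ n) (m ⊕ n) S} (h : IsUnit (blockDet Z)) :
    chartB t Z * chartA t Z = t • 1 := by
  have h₁ := Matrix.nonsing_inv_mul _ (isUnit_of_mul_isUnit_left h)
  have h₂ := Matrix.mul_nonsing_inv _ (isUnit_of_mul_isUnit_right h)
  simp only [chartA, chartB, fromBlocks_multiply, ← fromBlocks_one, fromBlocks_smul]
  congr 1
  · simp [Matrix.add_mul, Matrix.mul_assoc, h₁]
  · simp [Matrix.mul_add, Matrix.add_mul, Matrix.mul_assoc, h₂]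
  · simp [Matrix.mul_assoc, h₁]
  · simp [Matrix.mul_add, Matrix.mul_assoc, h₂]

/-- One half of the bijection between parameters and pairs; it needs no invertibility. The other
half is `eq_chartA_of_mul_eq` together with `eq_chartB_of_mul_eq`. -/
lemma glue_chart (t : S) (Z : Matrix (m ⊕ n) (m ⊕ n) S) : glue (chartA t Z) (chartB t Z) = Z := by
  simp [glue, chartA, chartB, fromBlocks_toBlocks]

/-- Under an invertible upper left block, the second matrix is determined by the first one
and its own lower right block. -/
lemma eq_chartB_of_mul_eq {t : S} {A B : Matrix (m ⊕ n) (m ⊕ n) S} (hAB : A * B = t • 1)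
    (hBA : B * A = t • 1) (h : IsUnit A.toBlocks₁₁.det) : B = chartB t (glue A B) := by
  have h₁ := Matrix.nonsing_inv_mul _ h
  have h₂ := Matrix.mul_nonsing_inv _ h
  rw [← fromBlocks_toBlocks A, ← fromBlocks_toBlocks B, fromBlocks_multiply, ← fromBlocks_one,
    fromBlocks_smul, fromBlocks_inj] at hAB hBA
  -- Three block equations suffice: `A₁₁ B₁₁ + A₁₂ B₂₁ = t` and `A₁₁ B₁₂ + A₁₂ B₂₂ = 0` from `A B`,
  -- and `B₂₁ A₁₁ + B₂₂ A₂₁ = 0` from `B A`. Each is solved by cancelling `A₁₁`.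
  obtain ⟨e₁, e₂, -, -⟩ := hAB
  obtain ⟨-, -, e₃, -⟩ := hBA
  generalize hI : A.toBlocks₁₁⁻¹ = I at *
  have f₂ : B.toBlocks₁₂ = -(I * A.toBlocks₁₂ * B.toBlocks₂₂) := by
    have := congrArg (I * ·) e₂
    simp only [Matrix.mul_add, ← Matrix.mul_assoc, h₁, Matrix.one_mul, smul_zero, Matrix.mul_zero] at this
    exact eq_neg_of_add_eq_zero_left this
  have f₃ : B.toBlocks₂₁ = -(B.toBlocks₂₂ * A.toBlocks₂₁ * I) := by
    have := congrArg (· * I) e₃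
    simp only [Matrix.add_mul, Matrix.mul_assoc, h₂, Matrix.mul_one, smul_zero, Matrix.zero_mul] at this
    simpa only [Matrix.mul_assoc] using eq_neg_of_add_eq_zero_left this
  have f₁ : B.toBlocks₁₁ = t • I + I * A.toBlocks₁₂ * B.toBlocks₂₂ * A.toBlocks₂₁ * I := by
    have := congrArg (I * ·) e₁
    simp only [Matrix.mul_add, ← Matrix.mul_assoc, h₁, Matrix.one_mul, Matrix.mul_smul, Matrix.mul_one] at this
    rw [← this, f₃]
    simp [Matrix.mul_assoc]
  conv_lhs => rw [← fromBlocks_toBlocks B, f₁, f₂, f₃]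
  simp [chartB, glue, hI]

/-- Substitute the known `B₁₂ = -A₁₁⁻¹ A₁₂ B₂₂` into the lower right block `A₂₁ B₁₂ + A₂₂ B₂₂ = t`
of `A B`, then cancel `B₂₂` on the right. -/
lemma eq_chartA_of_mul_eq {t : S} {A B : Matrix (m ⊕ n) (m ⊕ n) S} (hAB : A * B = t • 1)
    (hBA : B * A = t • 1) (h : IsUnit (blockDet (glue A B))) : A = chartA t (glue A B) := by
  have hA : IsUnit A.toBlocks₁₁.det := by
    simpa [blockDet, glue] using isUnit_of_mul_isUnit_left h
  have hB : IsUnit B.toBlocks₂₂.det := by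
    simpa [blockDet, glue] using isUnit_of_mul_isUnit_right h
  have h₂ := Matrix.mul_nonsing_inv _ hB
  have f := congrArg toBlocks₁₂ (eq_chartB_of_mul_eq hAB hBA hA)
  simp only [chartB, glue, toBlocks_fromBlocks₁₁, toBlocks_fromBlocks₁₂, toBlocks_fromBlocks₂₂]
    at f
  rw [← fromBlocks_toBlocks A, ← fromBlocks_toBlocks B, fromBlocks_multiply, ← fromBlocks_one,
    fromBlocks_smul, fromBlocks_inj] at hAB
  obtain ⟨-, -, -, e⟩ := hAB
  have e' := congrArg (· * B.toBlocks₂₂⁻¹) e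
  simp only [f, Matrix.add_mul, Matrix.mul_assoc, h₂, Matrix.mul_neg, Matrix.neg_mul, Matrix.mul_one, Matrix.smul_mul, Matrix.one_mul] at e'
  have f' : A.toBlocks₂₂ = A.toBlocks₂₁ * A.toBlocks₁₁⁻¹ * A.toBlocks₁₂ + t • B.toBlocks₂₂⁻¹ := by
    rw [← e', Matrix.mul_assoc]
    abel
  conv_lhs => rw [← fromBlocks_toBlocks A, f']
  simp [chartA, glue]

section Map

variable {T : Type*} [CommRing T] (f : S →+* T)

/-- Invertibility matters: the matrix inverse is `0` by convention when the determinant is not a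
unit, and the determinant may become a unit under `f`. -/
lemma map_nonsing_inv {M : Matrix n n S} (h : IsUnit M.det) : (M⁻¹).map f = (M.map f)⁻¹ := by
  refine (inv_eq_right_inv ?_).symm
  rw [← Matrix.map_mul, mul_nonsing_inv _ h, Matrix.map_one _ (map_zero f) (map_one f)]

lemma blockDet_map (Z : Matrix (m ⊕ n) (m ⊕ n) S) : blockDet (Z.map f) = f (blockDet Z) := by
  rw [blockDet, blockDet, map_mul, RingHom.map_det, RingHom.map_det]; rfl

lemma chartA_map (t : S) {Z : Matrix (m ⊕ n) (m ⊕ n) S} (h : IsUnit (blockDet Z)) :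
    (chartA t Z).map f = chartA (f t) (Z.map f) := by
  simp only [chartA, fromBlocks_map, Matrix.map_add f (map_add f), Matrix.map_mul,
    map_nonsing_inv f (isUnit_of_mul_isUnit_left h), map_smul_ringHom f,
    map_nonsing_inv f (isUnit_of_mul_isUnit_right h)]
  rfl

lemma chartB_map (t : S) {Z : Matrix (m ⊕ n) (m ⊕ n) S} (h : IsUnit (blockDet Z)) :
    (chartB t Z).map f = chartB (f t) (Z.map f) := by
  simp only [chartB, fromBlocks_map, Matrix.map_add f (map_add f), Matrix.map_mul,
    map_nonsing_inv f (isUnit_of_mul_isUnit_left h), map_smul_ringHom f,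
    Matrix.map_neg f (map_neg f)]
  rfl

end Map

end Chart

/-! ### Pairs over a field: the rank condition yields a chart -/

section Field

variable {K : Type*} [Field K]

lemma isUnit_det_of_card_le_rank {n : Type*} [Fintype n] [DecidableEq n] {M : Matrix n n K}
    (h : Fintype.card n ≤ M.rank) : IsUnit M.det := by
  rw [← Matrix.isUnit_iff_isUnit_det, ← Matrix.linearIndependent_rows_iff_isUnit,
    linearIndependent_iff_card_eq_finrank_span, Set.finrank, ← Matrix.rank_eq_finrank_span_row]
  exact le_antisymm h M.rank_le_card_width

/-- If the upper left block of the first matrix is invertible of the size of the rank of that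
matrix, and the ranks add up to at least the size of the matrices, then the lower right block of
the second matrix is invertible. -/
lemma isUnit_det_toBlocks₂₂ {m n : Type*} [Fintype m] [Fintype n] [DecidableEq m] [DecidableEq n]
    {t : K} {A B : Matrix (m ⊕ n) (m ⊕ n) K} (hAB : A * B = t • 1) (hBA : B * A = t • 1)
    (hA : IsUnit A.toBlocks₁₁.det) (hr : A.rank = Fintype.card m)
    (h : Fintype.card m + Fintype.card n ≤ A.rank + B.rank) : IsUnit B.toBlocks₂₂.det := by
  by_cases ht : t = 0
  · subst ht
    apply isUnit_det_of_card_le_rank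
    have hB := eq_chartB_of_mul_eq hAB hBA hA
    -- At `t = 0` the formula for `B` factors through `B₂₂`, as the block column `(-A₁₁⁻¹ A₁₂, 1)`
    -- times `B₂₂` times the block row `(-A₂₁ A₁₁⁻¹, 1)`. The column is itself written as a square
    -- matrix times `fromRows 0 1`.
    have hB' : B = fromBlocks (0 : Matrix m m K) (-(A.toBlocks₁₁⁻¹ * A.toBlocks₁₂)) 0 1 *
        (fromRows (0 : Matrix m n K) 1 * B.toBlocks₂₂ *
          fromCols (-(A.toBlocks₂₁ * A.toBlocks₁₁⁻¹)) 1) := by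
      conv_lhs => rw [hB]
      simp [chartB, glue, fromRows_mul, fromBlocks_multiply, Matrix.mul_assoc]
    have h₁ : B.rank ≤ B.toBlocks₂₂.rank := by
      conv_lhs => rw [hB']
      exact (rank_mul_le_right _ _).trans ((rank_mul_le_left _ _).trans (rank_mul_le_right _ _))
    omega
  -- For `t ≠ 0` the matrix `A` has full rank, so the second block is empty and its determinant is
  -- `1`.
  · have hA' : IsUnit A := IsUnit.of_mul_eq_one (t⁻¹ • B) (by simp [hAB, ht])
    have := rank_of_isUnit A hA'
    rw [hr, Fintype.card_sum] at this
    have : IsEmpty n := Fintype.card_eq_zero_iff.mp (by omega)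
    simp

lemma exists_equiv_sum_extending {r d : ℕ} {f : Fin r → Fin d} (hf : Function.Injective f) :
    ∃ e : Fin r ⊕ Fin (d - r) ≃ Fin d, ∀ i, e (Sum.inl i) = f i := by
  classical
  have hc : Fintype.card (Fin (d - r)) = Fintype.card ↑(Set.range f)ᶜ := by
    rw [Fintype.card_compl_set, Set.card_range_of_injective hf]; simp
  exact ⟨((Equiv.ofInjective f hf).sumCongr (Fintype.equivOfCardEq hc)).trans
    (Equiv.Set.sumCompl _), fun i => by simp⟩

/-- A nonzero minor of `A` of maximal size is moved to the upper left corner by `σ` on rows and `τ`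
on columns. The roles are swapped for `B`, so that the permuted matrices still multiply to `t` in
both orders. -/
lemma exists_isUnit_blockDet {d : ℕ} {t : K} {A B : Matrix (Fin d) (Fin d) K}
    (hAB : A * B = t • 1) (hBA : B * A = t • 1) (h : d ≤ A.rank + B.rank) :
    ∃ (r : ℕ) (σ τ : Fin r ⊕ Fin (d - r) ≃ Fin d),
      IsUnit (blockDet (glue (A.submatrix σ τ) (B.submatrix τ σ))) := by
  obtain ⟨f, g, hfg⟩ := exists_minor_ne_zero A
  have hf : Function.Injective f := fun i j hij => by
    by_contra hne
    exact hfg (det_zero_of_row_eq hne (by ext k; simp [hij]))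
  have hg : Function.Injective g := fun i j hij => by
    by_contra hne
    exact hfg (det_zero_of_column_eq hne (by intro k; simp [hij]))
  obtain ⟨σ, hσ⟩ := exists_equiv_sum_extending hf
  obtain ⟨τ, hτ⟩ := exists_equiv_sum_extending hg
  refine ⟨_, σ, τ, ?_⟩
  have h₁₁ : (A.submatrix σ τ).toBlocks₁₁ = A.submatrix f g := by
    ext i j; simp [toBlocks₁₁, hσ, hτ]
  have hu : IsUnit (A.submatrix σ τ).toBlocks₁₁.det := by rw [h₁₁]; exact hfg.isUnit
  have hr : A.rank ≤ d := A.rank_le_width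
  have := isUnit_det_toBlocks₂₂ (t := t) (A := A.submatrix σ τ) (B := B.submatrix τ σ)
    (by rw [submatrix_mul_equiv, hAB, submatrix_smul, Pi.smul_apply, Pi.smul_apply, submatrix_one_equiv])
    (by rw [submatrix_mul_equiv, hBA, submatrix_smul, Pi.smul_apply, Pi.smul_apply, submatrix_one_equiv]) hu
    (by rw [rank_submatrix]; simp) (by simp only [rank_submatrix, Fintype.card_fin]; omega)
  simpa [blockDet, glue] using hu.mul this

end Field

/-! ### Affine space is standard smooth -/

section StandardSmooth

lemma isStandardSmoothOfRelativeDimension_mvPolynomial (R : Type*) [CommRing R] (ι : Type*)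
    [Finite ι] :
    Algebra.IsStandardSmoothOfRelativeDimension (Nat.card ι) R (MvPolynomial ι R) := by
  -- The presentation has no relations: the Jacobian is the determinant of an empty matrix, and the
  -- dimension is the number of variables.
  let P : Algebra.SubmersivePresentation R (MvPolynomial ι R) ι PEmpty.{1} :=
    { Algebra.Generators.mvPolynomial R ι with
      relation := PEmpty.elim
      span_range_relation_eq_ker := by
        rw [Set.range_eq_empty, Ideal.span_empty, eq_comm, Algebra.Generators.ker_eq_ker_aeval_val]
        exact (RingHom.injective_iff_ker_eq_bot _).mp
          (MvPolynomial.aeval_X_left (σ := ι) (R := R) ▸ Function.injective_id)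
      map := PEmpty.elim
      map_inj := fun x => x.elim
      jacobian_isUnit := by
        classical
        rw [Algebra.PreSubmersivePresentation.jacobian_eq_jacobiMatrix_det, det_isEmpty, map_one]
        exact isUnit_one }
  exact P.isStandardSmoothOfRelativeDimension (by simp [Algebra.Presentation.dimension])

end StandardSmooth

/-! ### The chart of the universal pair as a principal open in affine space -/

section UniversalPair

variable {d : ℕ} {R C : Type} [CommRing R] [CommRing C] [Algebra R C]

/-- The pair `A`, `B` is universal among the pairs of matrices over `R`-algebras with
`A B = B A = t I`. -/
structure IsUniversalPair (t : R) (A B : Matrix (Fin d) (Fin d) C) : Prop where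
  mul_eq : A * B = algebraMap R C t • 1
  mul_eq' : B * A = algebraMap R C t • 1
  exists_algHom : ∀ {S : Type} [CommRing S] [Algebra R S] (A' B' : Matrix (Fin d) (Fin d) S),
    A' * B' = algebraMap R S t • 1 → B' * A' = algebraMap R S t • 1 →
      ∃ g : C →ₐ[R] S, A.map g = A' ∧ B.map g = B'
  algHom_ext : ∀ {S : Type} [CommRing S] [Algebra R S] {f g : C →ₐ[R] S},
    A.map f = A.map g → B.map f = B.map g → f = g

/-- The chart of the universal pair on which two complementary minors are invertible is a principal
open in an affine space. -/
theorem IsUniversalPair.nonempty_algEquiv_away {t : R} {A B : Matrix (Fin d) (Fin d) C}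
    (h : IsUniversalPair t A B) {m n : Type} [Fintype m] [Fintype n] [DecidableEq m]
    [DecidableEq n] (σ τ : m ⊕ n ≃ Fin d) :
    Nonempty (Localization.Away (blockDet (mvPolynomialX (m ⊕ n) (m ⊕ n) R)) ≃ₐ[R]
      Localization.Away (blockDet (glue (A.submatrix σ τ) (B.submatrix τ σ)))) := by
  set X := mvPolynomialX (m ⊕ n) (m ⊕ n) R with hX
  set W := glue (A.submatrix σ τ) (B.submatrix τ σ) with hW
  set P := Localization.Away (blockDet X)
  set Q := Localization.Away (blockDet W)
  let p : MvPolynomial ((m ⊕ n) × (m ⊕ n)) R →ₐ[R] P := Algebra.algHom _ _ _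
  let q : C →ₐ[R] Q := Algebra.algHom _ _ _
  let f : MvPolynomial ((m ⊕ n) × (m ⊕ n)) R →ₐ[R] C :=
    MvPolynomial.aeval fun x => W x.1 x.2
  have hfX : X.map f = W := by ext i j; simp [f, hX]
  set Z : Matrix (m ⊕ n) (m ⊕ n) P := X.map p with hZ
  set s := algebraMap R P t with hs
  have hu : IsUnit (blockDet Z) := by
    have : blockDet Z = p (blockDet X) := blockDet_map p.toRingHom _
    rw [this]
    exact IsLocalization.Away.algebraMap_isUnit _
  -- The chart formulas over `P` give a pair there, with the permutations undone; universality turns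
  -- it into a map out of `C`.
  obtain ⟨g, hgA, hgB⟩ := h.exists_algHom ((chartA s Z).submatrix σ.symm τ.symm)
    ((chartB s Z).submatrix τ.symm σ.symm)
    (by rw [submatrix_mul_equiv, chartA_mul_chartB s hu, submatrix_smul, Pi.smul_apply,
      Pi.smul_apply, submatrix_one_equiv])
    (by rw [submatrix_mul_equiv, chartB_mul_chartA s hu, submatrix_smul, Pi.smul_apply,
      Pi.smul_apply, submatrix_one_equiv])
  have hgW : W.map g = Z := by
    have : W.map g = glue ((A.map g).submatrix σ τ) ((B.map g).submatrix τ σ) :=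
      glue_map g.toRingHom _ _
    rw [this, hgA, hgB]
    simp [glue_chart]
  have hg : IsUnit (g (blockDet W)) := by
    have : g (blockDet W) = blockDet (W.map g) := (blockDet_map g.toRingHom _).symm
    rwa [this, hgW]
  have hqW : IsUnit (q (blockDet W)) := IsLocalization.Away.algebraMap_isUnit _
  have hf : IsUnit ((q.comp f) (blockDet X)) := by
    have : f (blockDet X) = blockDet (X.map f) := (blockDet_map f.toRingHom _).symm
    rwa [AlgHom.comp_apply, this, hfX]
  let F : P →ₐ[R] Q := IsLocalization.Away.liftAlgHom (f := q.comp f) _ hf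
  let G : Q →ₐ[R] P := IsLocalization.Away.liftAlgHom (f := g) _ hg
  have hF : ∀ x, F (p x) = q (f x) := fun x => IsLocalization.Away.lift_eq _ hf x
  have hG : ∀ x, G (q x) = g x := fun x => IsLocalization.Away.lift_eq _ hg x
  have hFZ : Z.map F = W.map q := by
    calc Z.map F = (X.map f).map q := by
          rw [hZ, Matrix.map_map, Matrix.map_map]
          exact congrArg _ (funext hF)
      _ = W.map q := by rw [hfX]
  have huq : IsUnit (blockDet (W.map q)) := by
    have : blockDet (W.map q) = q (blockDet W) := blockDet_map q.toRingHom _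
    rwa [this]
  have hWq : W.map q = glue ((A.map q).submatrix σ τ) ((B.map q).submatrix τ σ) :=
    glue_map q.toRingHom _ _
  have hq : (A.map q) * (B.map q) = algebraMap R Q t • 1 := by
    rw [← Matrix.map_mul, h.mul_eq]
    refine (map_smul_ringHom q.toRingHom _ _).trans ?_
    rw [Matrix.map_one _ (map_zero _) (map_one _)]
    exact congrArg (· • 1) (q.commutes t)
  have hq' : (B.map q) * (A.map q) = algebraMap R Q t • 1 := by
    rw [← Matrix.map_mul, h.mul_eq']
    refine (map_smul_ringHom q.toRingHom _ _).trans ?_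
    rw [Matrix.map_one _ (map_zero _) (map_one _)]
    exact congrArg (· • 1) (q.commutes t)
  have hσ : (A.map q).submatrix σ τ * (B.map q).submatrix τ σ = algebraMap R Q t • 1 := by
    rw [submatrix_mul_equiv, hq, submatrix_smul, Pi.smul_apply, Pi.smul_apply, submatrix_one_equiv]
  have hτ : (B.map q).submatrix τ σ * (A.map q).submatrix σ τ = algebraMap R Q t • 1 := by
    rw [submatrix_mul_equiv, hq', submatrix_smul, Pi.smul_apply, Pi.smul_apply,
      submatrix_one_equiv]
  have hFs : F s = algebraMap R Q t := F.commutes t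
  have hFA : (chartA s Z).map F = (A.map q).submatrix σ τ := by
    rw [show (chartA s Z).map F = chartA (F s) (Z.map F) from chartA_map F.toRingHom s hu, hFZ,
      hFs, eq_chartA_of_mul_eq hσ hτ (hWq ▸ huq), ← hWq]
  have hFB : (chartB s Z).map F = (B.map q).submatrix τ σ := by
    rw [show (chartB s Z).map F = chartB (F s) (Z.map F) from chartB_map F.toRingHom s hu, hFZ,
      hFs, eq_chartB_of_mul_eq hσ hτ, ← hWq]
    rw [hWq] at huq
    simpa [blockDet, glue] using isUnit_of_mul_isUnit_left huq
  refine ⟨AlgEquiv.ofAlgHom F G ?_ ?_⟩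
  -- By universality, `F ∘ G` need only be checked on `A` and `B`: a pair over `Q` is recovered from
  -- its parameter by the chart formulas.
  · refine IsLocalization.algHom_ext (Submonoid.powers (blockDet W)) (h.algHom_ext ?_ ?_)
    · calc A.map (fun x => F (G (q x))) = (A.map g).map F := by simp only [hG]; rfl
        _ = ((chartA s Z).map F).submatrix σ.symm τ.symm := by rw [hgA]; rfl
        _ = A.map q := by rw [hFA]; simp
    · calc B.map (fun x => F (G (q x))) = (B.map g).map F := by simp only [hG]; rfl
        _ = ((chartB s Z).map F).submatrix τ.symm σ.symm := by rw [hgB]; rfl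
        _ = B.map q := by rw [hFB]; simp
  -- `G ∘ F` need only be checked on the coordinates: the parameter of the chart pair of `Z` is `Z`
  -- again.
  · refine IsLocalization.algHom_ext (Submonoid.powers (blockDet X))
      (MvPolynomial.algHom_ext fun x => ?_)
    change G (F (p (X x.1 x.2))) = p (X x.1 x.2)
    rw [hF, hG]
    have : (X.map f).map g = X.map p := by rw [hfX, hgW]
    exact congrFun (congrFun this x.1) x.2

end UniversalPair

/-! ### Standard smooth neighbourhoods in the coordinate ring -/

section Smooth

/-- This is all that the smoothness argument uses about the presentation of the coordinate ring. -/
theorem isUniversalPair_univ (d : ℕ) :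
    IsUniversalPair (Polynomial.X : Polynomial ℤ) (univA d) (univB d) where
  mul_eq := by
    have h : (genericA d * genericB d - scalarT d).map (Ideal.Quotient.mk (relations d)) = 0 := by
      ext i j
      exact Ideal.Quotient.eq_zero_iff_mem.mpr (Ideal.subset_span (.inl ⟨(i, j), rfl⟩))
    rw [Matrix.map_sub _ (map_sub _), Matrix.map_mul, sub_eq_zero] at h
    refine h.trans ?_
    ext i j
    by_cases hij : i = j
    · simp [scalarT, hij]; rfl
    · simp [scalarT, hij]
  mul_eq' := by
    have h : (genericB d * genericA d - scalarT d).map (Ideal.Quotient.mk (relations d)) = 0 := by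
      ext i j
      exact Ideal.Quotient.eq_zero_iff_mem.mpr (Ideal.subset_span (.inr ⟨(i, j), rfl⟩))
    rw [Matrix.map_sub _ (map_sub _), Matrix.map_mul, sub_eq_zero] at h
    refine h.trans ?_
    ext i j
    by_cases hij : i = j
    · simp [scalarT, hij]; rfl
    · simp [scalarT, hij]
  exists_algHom {S} _ _ A B hAB hBA := by
    let f : EntryRing d →ₐ[Polynomial ℤ] S :=
      MvPolynomial.aeval (Sum.elim (fun p => A p.1 p.2) (fun p => B p.1 p.2))
    have hA : (genericA d).map f = A := by ext i j; simp [genericA, f]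
    have hB : (genericB d).map f = B := by ext i j; simp [genericB, f]
    have hT : (scalarT d).map f = algebraMap (Polynomial ℤ) S Polynomial.X • 1 := by
      ext i j
      by_cases hij : i = j
      · simp [scalarT, hij, f]
      · simp [scalarT, hij, f]
    have h : relations d ≤ RingHom.ker f := by
      refine Ideal.span_le.mpr ?_
      rintro _ (⟨p, rfl⟩ | ⟨p, rfl⟩)
      · have : (genericA d * genericB d - scalarT d).map f = 0 := by
          rw [Matrix.map_sub _ (map_sub _), Matrix.map_mul, hA, hB, hAB, hT, sub_self]
        exact congrFun (congrFun this p.1) p.2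
      · have : (genericB d * genericA d - scalarT d).map f = 0 := by
          rw [Matrix.map_sub _ (map_sub _), Matrix.map_mul, hA, hB, hBA, hT, sub_self]
        exact congrFun (congrFun this p.1) p.2
    refine ⟨Ideal.Quotient.liftₐ (relations d) f fun a ha => h ha, ?_, ?_⟩
    · exact hA
    · exact hB
  algHom_ext {S} _ _ f g hA hB := by
    refine Ideal.Quotient.algHom_ext _ (MvPolynomial.algHom_ext ?_)
    rintro (p | p)
    · exact congrFun (congrFun hA p.1) p.2
    · exact congrFun (congrFun hB p.1) p.2

/-- Around a point at which the ranks add up to at least the size of the matrices, a universal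
pair is standard smooth. -/
theorem IsUniversalPair.exists_isStandardSmooth {d : ℕ} {R C : Type} [CommRing R] [CommRing C]
    [Algebra R C] {t : R} {A B : Matrix (Fin d) (Fin d) C} (h : IsUniversalPair t A B)
    (x : PrimeSpectrum C) (hx : d ≤ rankAt A x + rankAt B x) :
    ∃ g : C, x ∈ PrimeSpectrum.basicOpen g ∧
      Algebra.IsStandardSmoothOfRelativeDimension (d ^ 2) R (Localization.Away g) := by
  let f := algebraMap C x.asIdeal.ResidueField
  have h₁ : A.map f * B.map f = f (algebraMap R C t) • 1 := by
    rw [← Matrix.map_mul, h.mul_eq, map_smul_ringHom, Matrix.map_one f (map_zero f) (map_one f)]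
  have h₂ : B.map f * A.map f = f (algebraMap R C t) • 1 := by
    rw [← Matrix.map_mul, h.mul_eq', map_smul_ringHom, Matrix.map_one f (map_zero f) (map_one f)]
  obtain ⟨r, σ, τ, hu⟩ := exists_isUnit_blockDet h₁ h₂ hx
  refine ⟨blockDet (glue (A.submatrix σ τ) (B.submatrix τ σ)), ?_, ?_⟩
  · have hm : blockDet (glue ((A.map f).submatrix σ τ) ((B.map f).submatrix τ σ)) =
        f (blockDet (glue (A.submatrix σ τ) (B.submatrix τ σ))) := by
      rw [← blockDet_map, glue_map]; rfl
    rw [hm] at hu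
    have := hu.ne_zero
    rwa [Ne, Ideal.algebraMap_residueField_eq_zero] at this
  · obtain ⟨e⟩ := h.nonempty_algEquiv_away σ τ
    set X := mvPolynomialX (Fin r ⊕ Fin (d - r)) (Fin r ⊕ Fin (d - r)) R
    have := isStandardSmoothOfRelativeDimension_mvPolynomial R
      ((Fin r ⊕ Fin (d - r)) × (Fin r ⊕ Fin (d - r)))
    -- Inverting one element has relative dimension `0`, so the principal open keeps the dimension
    -- of affine space.
    have := Algebra.IsStandardSmoothOfRelativeDimension.localization_away
      (S := Localization.Away (blockDet X)) (blockDet X)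
    have := Algebra.IsStandardSmoothOfRelativeDimension.trans
      (Nat.card ((Fin r ⊕ Fin (d - r)) × (Fin r ⊕ Fin (d - r)))) 0 R
      (MvPolynomial ((Fin r ⊕ Fin (d - r)) × (Fin r ⊕ Fin (d - r))) R)
      (Localization.Away (blockDet X))
    have hd : 0 + Nat.card ((Fin r ⊕ Fin (d - r)) × (Fin r ⊕ Fin (d - r))) = d ^ 2 := by
      rw [Nat.card_prod, Nat.card_congr σ, Nat.card_fin, zero_add, sq]
    rw [hd] at this
    exact .of_algEquiv _ e

end Smooth

/-! ### From standard smooth algebras to smooth morphisms -/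

section Scheme

universe u

open TopologicalSpace

instance (n : ℕ) : IsZariskiLocalAtSource (@SmoothOfRelativeDimension.{u} n) :=
  HasRingHomProperty.instIsZariskiLocalAtSource (P := @SmoothOfRelativeDimension n)

/-- A morphism is smooth of relative dimension `n` on an open subscheme if every point of it has an
open neighbourhood on which the morphism is. -/
lemma smoothOfRelativeDimension_of_forall_exists {X Y : Scheme.{u}} (f : X ⟶ Y) (n : ℕ)
    (U : X.Opens) (h : ∀ x ∈ U, ∃ V : X.Opens, x ∈ V ∧ SmoothOfRelativeDimension n (V.ι ≫ f)) :
    SmoothOfRelativeDimension n (U.ι ≫ f) := by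
  choose V hxV hV using h
  refine IsZariskiLocalAtSource.of_iSup_eq_top (P := @SmoothOfRelativeDimension n)
    (fun x : U => U.ι ⁻¹ᵁ V x.1 x.2) ?_ fun x => ?_
  · rw [eq_top_iff]
    rintro x -
    exact Opens.mem_iSup.mpr ⟨x, hxV _ _⟩
  · rw [← Category.assoc]
    have : (U.ι ⁻¹ᵁ V x.1 x.2).ι ≫ U.ι = (U.ι ∣_ V x.1 x.2) ≫ (V x.1 x.2).ι :=
      (morphismRestrict_ι _ _).symm
    rw [this, Category.assoc]
    exact IsZariskiLocalAtSource.comp (P := @SmoothOfRelativeDimension n) (hV _ _) _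

/-- The basic open of `g` is the spectrum of the localization at `g`, which reduces the claim to the
ring map from `R` to that localization. -/
lemma smoothOfRelativeDimension_basicOpen_ι {R C : Type u} [CommRing R] [CommRing C] [Algebra R C]
    (n : ℕ) (g : C) [Algebra.IsStandardSmoothOfRelativeDimension n R (Localization.Away g)] :
    SmoothOfRelativeDimension n (Scheme.Opens.ι (X := Spec (CommRingCat.of C))
      (PrimeSpectrum.basicOpen g) ≫ Spec.map (CommRingCat.ofHom (algebraMap R C))) := by
  rw [← basicOpenIsoSpecAway_hom_SpecMap (R := CommRingCat.of C) g, Category.assoc,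
    ← Spec.map_comp, ← CommRingCat.ofHom_comp]
  refine IsZariskiLocalAtSource.comp (P := @SmoothOfRelativeDimension n) ?_ _
  rw [HasRingHomProperty.Spec_iff (P := @SmoothOfRelativeDimension n)]
  refine RingHom.locally_of RingHom.isStandardSmoothOfRelativeDimension_respectsIso _ ?_
  have : (algebraMap C (Localization.Away g)).comp (algebraMap R C) =
      algebraMap R (Localization.Away g) := (IsScalarTower.algebraMap_eq _ _ _).symm
  change RingHom.IsStandardSmoothOfRelativeDimension n
    ((algebraMap C (Localization.Away g)).comp (algebraMap R C))
  rw [this, RingHom.isStandardSmoothOfRelativeDimension_algebraMap]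
  infer_instance

end Scheme

end MatrixPairs

theorem propositionA5 (d : ℕ) (hd : 0 < d) :
    AlgebraicGeometry.SmoothOfRelativeDimension (d ^ 2) (MatrixPairs.U.toBase d) := by
  refine MatrixPairs.smoothOfRelativeDimension_of_forall_exists _ _ _ fun x hx => ?_
  obtain ⟨g, hxg, hg⟩ := (MatrixPairs.isUniversalPair_univ d).exists_isStandardSmooth x hx
  exact ⟨PrimeSpectrum.basicOpen g, hxg,
    MatrixPairs.smoothOfRelativeDimension_basicOpen_ι (d ^ 2) g⟩
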